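/- For integers $p\ge 0$ and real $x$ with $|x|<1$ let $\mathrm{Li}_p(x)=\sum_{k\ge 1}x^k/k^p$ (so $\mathrm{Li}_0(x)=x/(1-x)$), and write \[ K(r,p,q)=\int_0^1\frac{\log^r(x)\,\mathrm{Li}_p(x)\,\mathrm{Li}_q(x)}{x}\,dx . \] Let $q\ge 2$ and $r\ge 1$ be integers such that $w=q+r$ is even. Then $\log^r(x)\,\mathrm{Li}_q(x)/(1-x)$ is integrable on $(0,1)$, and the integral \[ K(r,0,q)=\int_0^1\frac{\log^r(x)\,\mathrm{Li}_q(x)}{1-x}\,dx \] is reducible to zeta values, that is, it is a rational linear combination of finite (possibly empty) products of values $\zeta(n)$ with integers $n\ge 2$. More precisely, \[ \begin{aligned} K(r,0,q)=r!\Big\{&(-1)^{r+1}\zeta(w+1)\Big[\tfrac12-\tfrac{(-1)^{r+1}}{2}\tbinom{w}{r+1}-\tfrac{(-1)^{r+1}}{2}\tbinom{w}{q}\Big] +\tfrac{(-1)^r-1}{2}\,\zeta(r+1)\zeta(q)\\ &+\sum_{k=1}^{\lfloor (r+1)/2\rfloor}\tbinom{w-2k}{q-1}\zeta(2k)\zeta(w-2k+1)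 +\sum_{k=1}^{\lfloor q/2\rfloor}\tbinom{w-2k}{r}\zeta(2k)\zeta(w-2k+1)\Big\}, \end{aligned} \] where $\zeta(1)$ is to be read as $0$ whenever it occurs. -/

import Mathlib

/-- The polylogarithm `Li_p(x) = ∑_{k ≥ 1} x ^ k / k ^ p`, where `|x| < 1`; the index is shifted by
one. For `p = 0` this is the geometric series `x / (1 - x)`. -/
noncomputable def polylog (p : ℕ) (x : ℝ) : ℝ :=
  ∑' k : ℕ, x ^ (k + 1) / ((k : ℝ) + 1) ^ p

/-- The integral `K(r, p, q) = ∫₀¹ log^r(x) Li_p(x) Li_q(x) / x dx`. -/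
noncomputable def polylogIntegral (r p q : ℕ) : ℝ :=
  ∫ x in (0 : ℝ)..1, Real.log x ^ r * polylog p x * polylog q x / x

/-- The value of the Riemann zeta function at a positive integer, as a real number, with `ζ(1)`
read as `0`. -/
noncomputable def zetaValue (n : ℕ) : ℝ :=
  if n = 1 then 0 else (riemannZeta (n : ℂ)).re

/-- For `n ≥ 2` taking the real part loses nothing. -/
theorem ofReal_zetaValue {n : ℕ} (hn : 2 ≤ n) : ((zetaValue n : ℝ) : ℂ) = riemannZeta (n : ℂ) := by
  have h : riemannZeta (n : ℂ) = ((∑' k : ℕ, 1 / (k : ℝ) ^ n : ℝ) : ℂ) := by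
    rw [zeta_nat_eq_tsum_of_gt_one (by omega)]
    push_cast
    rfl
  rw [zetaValue, if_neg (by omega), h, Complex.ofReal_re]

/-- A real number is reducible to zeta values if it is a rational linear combination of finite products
(possibly empty) of values of the zeta function at integers `n ≥ 2`. -/
def ReducibleToZetaValues (x : ℝ) : Prop :=
  x ∈ Algebra.adjoin ℚ {y : ℝ | ∃ n : ℕ, 2 ≤ n ∧ y = zetaValue n}

/-!
Expanding `Li_q(x) / (1 - x)` into powers of `x` and integrating termwise, with
`∫₀¹ xⁿ logʳ x dx = (-1)ʳ r! / (n + 1)ʳ⁺¹`, gives `K(r, 0, q) = (-1)ʳ r! ζ(r + 1, q)`, where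
`ζ(s, t) = ∑_{n > m > 0} n⁻ˢ m⁻ᵗ` is the double zeta value (`integral_log_pow_mul_polylog`). Since
`w = q + r` is even, its weight `s + t = w + 1` is odd, and the claim is an instance of the parity
theorem for double zeta values.

The parity theorem follows from evaluating the sum of `n⁻ˢ m⁻ᵗ` over all pairs of nonzero integers
with `n + m > 0` in two ways. Splitting by the signs of `n` and `m` gives
`ζ(s) ζ(t) + (-1)ᵗ ζ(s, t) + (-1)ˢ ζ(t, s)` (`hasSum_halfPlane_signs`). Summing along the lines
`n + m = k` and expanding `n⁻ˢ (k - n)⁻ᵗ` into partial fractions gives products of single zeta values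
(`hasSum_halfPlane_lines`); only even arguments `2k` survive in one factor, because `∑ n⁻ⁱ` over the
nonzero integers vanishes for odd `i ≥ 3`, and the two divergent sums with exponent `1` cancel by
telescoping (`hasSum_int_inv_add_inv`). For odd `s + t` this determines `ζ(s, t) - ζ(t, s)`, while the
stuffle relation `zetaValue_mul_zetaValue` determines `ζ(s, t) + ζ(t, s)`; together they yield
`ζ(s, t)` (`two_mul_doubleZeta`).

Throughout, the convention `0⁻¹ = 0` lets sums over nonzero integers run over all of `ℤ`.
-/

/-! ### Partial fractions and finite sums -/

/-- Partial fractions: with `X = 1 / x`, `Y = 1 / y` and `L = 1 / (x + y)` one has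
`X * Y = L * (X + Y)`, and this relation alone expands `X ^ (a + 1) * Y ^ (b + 1)`. -/
theorem pow_mul_pow_eq_sum_of_mul_eq {R : Type*} [CommRing R] {X Y L : R}
    (h : X * Y = L * (X + Y)) (a b : ℕ) :
    X ^ (a + 1) * Y ^ (b + 1) =
      ∑ j ∈ Finset.range (a + 1), ((b + j).choose b : R) * X ^ (a + 1 - j) * L ^ (b + 1 + j) +
      ∑ j ∈ Finset.range (b + 1), ((a + j).choose a : R) * Y ^ (b + 1 - j) * L ^ (a + 1 + j) := by
  have pascal (Z : R) (a b : ℕ) :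
      ∑ j ∈ Finset.range (a + 1 + 1),
          ((b + 1 + j).choose (b + 1) : R) * Z ^ (a + 1 + 1 - j) * L ^ (b + 1 + 1 + j) =
        L * ∑ j ∈ Finset.range (a + 1),
          ((b + 1 + j).choose (b + 1) : R) * Z ^ (a + 1 - j) * L ^ (b + 1 + 1 + j) +
        L * ∑ j ∈ Finset.range (a + 1 + 1),
          ((b + j).choose b : R) * Z ^ (a + 1 + 1 - j) * L ^ (b + 1 + j) := by
    have e : ∀ j, (b + 1 + (j + 1)).choose (b + 1) =
        (b + (j + 1)).choose b + (b + 1 + j).choose (b + 1) := fun j ↦ by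
      rw [show b + 1 + (j + 1) = (b + 1 + j) + 1 by ring, Nat.choose_succ_succ,
        show b + (j + 1) = b + 1 + j by ring]
    rw [Finset.sum_range_succ' _ (a + 1), Finset.sum_range_succ' _ (a + 1), mul_add,
      Finset.mul_sum, Finset.mul_sum, ← add_assoc, ← Finset.sum_add_distrib]
    congr 1
    · refine Finset.sum_congr rfl fun j _ ↦ ?_
      rw [e, show a + 1 + 1 - (j + 1) = a + 1 - j by omega]
      push_cast
      ring
    · simp
      ring
  have base (X Y : R) (h : X * Y = L * (X + Y)) (b : ℕ) : X * Y ^ (b + 1) =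
      X * L ^ (b + 1) + ∑ j ∈ Finset.range (b + 1), Y ^ (b + 1 - j) * L ^ (1 + j) := by
    induction b with
    | zero => simp; linear_combination h
    | succ b ih =>
      rw [Finset.sum_range_succ']
      have : ∀ j, Y ^ (b + 1 + 1 - (j + 1)) * L ^ (1 + (j + 1)) =
          L * (Y ^ (b + 1 - j) * L ^ (1 + j)) := fun j ↦ by
        rw [show b + 1 + 1 - (j + 1) = b + 1 - j by omega]; ring
      simp only [this, ← Finset.mul_sum, tsub_zero, add_zero, pow_one]
      linear_combination Y ^ (b + 1) * h + L * ih
  induction a generalizing b with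
  | zero => simpa using base X Y h b
  | succ a iha =>
    induction b with
    | zero =>
      have := base Y X (by linear_combination h) (a + 1)
      simp only [zero_add, Finset.sum_range_one, pow_one, Nat.choose_zero_right, Nat.cast_one,
        one_mul, add_zero, Nat.choose_self, tsub_zero]
      linear_combination this
    | succ b ihb =>
      rw [pascal X a b, pascal Y b a]
      linear_combination X ^ (a + 1) * Y ^ (b + 1) * h + L * iha (b + 1) + L * ihb

theorem sum_range_one_add_neg_one_pow (F : ℕ → ℝ) (a : ℕ) :
    ∑ j ∈ Finset.range a, (1 + (-1) ^ (a + 1 - j)) * F (a + 1 - j) =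
      2 * ∑ k ∈ Finset.Icc 1 ((a + 1) / 2), F (2 * k) := by
  rw [← Finset.sum_range_reflect]
  have : ∀ j ∈ Finset.range a, (1 + (-1) ^ (a + 1 - (a - 1 - j))) * F (a + 1 - (a - 1 - j)) =
      (1 + (-1) ^ j) * F (j + 2) := fun j hj ↦ by
    rw [Finset.mem_range] at hj
    rw [show a + 1 - (a - 1 - j) = j + 2 by omega]
    ring
  rw [Finset.sum_congr rfl this]
  clear this
  induction a with
  | zero => simp
  | succ a ih =>
    rw [Finset.sum_range_succ, ih]
    rcases Nat.even_or_odd' a with ⟨c, rfl | rfl⟩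
    · rw [show (2 * c + 1 + 1) / 2 = c + 1 by omega, show (2 * c + 1) / 2 = c by omega,
        Finset.sum_Icc_succ_top (by omega)]
      rw [mul_add, (even_two_mul c).neg_one_pow, show 2 * c + 2 = 2 * (c + 1) by ring]
      ring
    · rw [show (2 * c + 1 + 1 + 1) / 2 = c + 1 by omega, show (2 * c + 1 + 1) / 2 = c + 1 by omega]
      simp [pow_succ]

theorem sum_range_add_choose_cast (a b : ℕ) :
    ∑ j ∈ Finset.range (a + 1), ((b + j).choose b : ℝ) = ((a + b + 1).choose (b + 1) : ℝ) := by
  have := Nat.sum_range_add_choose a b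
  exact_mod_cast (by simpa [add_comm] using this)

/-! ### Sums over the integers -/

/-- `n⁻ᵃ` for positive integers `n`, extended by zero to `ℤ`. -/
noncomputable def posInvPow (a : ℕ) (n : ℤ) : ℝ :=
  if 0 < n then (n : ℝ)⁻¹ ^ a else 0

/-- The double zeta value `∑_{n > m > 0} n⁻ˢ m⁻ᵗ`, as a sum over `ℤ × ℤ`. -/
noncomputable def doubleZeta (s t : ℕ) : ℝ :=
  ∑' p : ℤ × ℤ, if p.2 < p.1 then posInvPow s p.1 * posInvPow t p.2 else 0

theorem hasSum_posInvPow {a : ℕ} (ha : 2 ≤ a) : HasSum (posInvPow a) (zetaValue a) := by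
  have hs : Summable fun n : ℕ ↦ 1 / (n : ℝ) ^ a :=
    Real.summable_one_div_nat_pow.mpr (by omega)
  have hz : zetaValue a = ∑' n : ℕ, 1 / (n : ℝ) ^ a := by
    have : ((zetaValue a : ℝ) : ℂ) = ((∑' n : ℕ, 1 / (n : ℝ) ^ a : ℝ) : ℂ) := by
      rw [ofReal_zetaValue ha, zeta_nat_eq_tsum_of_gt_one (by omega)]
      push_cast
      rfl
    exact_mod_cast this
  rw [← Function.Injective.hasSum_iff (g := ((↑) : ℕ → ℤ)) Nat.cast_injective, hz]
  · convert hs.hasSum using 2 with n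
    rcases Nat.eq_zero_or_pos n with rfl | hn
    · simp [posInvPow, show a ≠ 0 by omega]
    · simp [posInvPow, hn]
  · intro n hn
    refine if_neg fun h ↦ hn ⟨n.toNat, by simp [h.le]⟩

theorem inv_pow_eq_posInvPow {a : ℕ} (ha : a ≠ 0) (n : ℤ) :
    (n : ℝ)⁻¹ ^ a = posInvPow a n + (-1) ^ a * posInvPow a (-n) := by
  rcases lt_trichotomy n 0 with h | rfl | h
  · simp only [posInvPow, if_neg h.not_gt, if_pos (neg_pos.mpr h), zero_add]
    rw [← mul_pow]
    push_cast
    simp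
  · simp [posInvPow, ha]
  · simp [posInvPow, h, h.le]

theorem hasSum_int_inv_pow {a : ℕ} (ha : 2 ≤ a) :
    HasSum (fun n : ℤ ↦ (n : ℝ)⁻¹ ^ a) ((1 + (-1) ^ a) * zetaValue a) := by
  have h := hasSum_posInvPow ha
  have h' : HasSum (posInvPow a ∘ Equiv.neg ℤ) (zetaValue a) := (Equiv.neg ℤ).hasSum_iff.mpr h
  have hadd := h.add (h'.mul_left ((-1) ^ a))
  rw [show (1 + (-1) ^ a) * zetaValue a = zetaValue a + (-1) ^ a * zetaValue a by ring]
  exact hadd.congr_fun fun n ↦ inv_pow_eq_posInvPow (show a ≠ 0 by omega) n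

/-- The exponent `1` part of the partial fractions: neither `∑ 1 / n` nor `∑ 1 / (k - n)` converges,
but their termwise sum does, by telescoping. -/
theorem hasSum_int_inv_add_inv (k : ℕ) :
    HasSum (fun n : ℤ ↦ (n : ℝ)⁻¹ + ((k : ℝ) - n)⁻¹) 0 := by
  have tel : HasSum (fun n : ℕ ↦ ((n : ℝ) + 1)⁻¹ - (n : ℝ)⁻¹) 0 := by
    have hlim : Filter.Tendsto (fun N : ℕ ↦ ((N : ℝ) + 1)⁻¹) Filter.atTop (nhds 0) := by
      simpa using tendsto_one_div_add_atTop_nhds_zero_nat (𝕜 := ℝ)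
    have h1 : HasSum (fun n : ℕ ↦ ((n : ℝ) + 1)⁻¹ - ((n : ℝ) + 1 + 1)⁻¹) 1 := by
      rw [hasSum_iff_tendsto_nat_of_nonneg]
      · have := fun N ↦ Finset.sum_range_sub' (fun n : ℕ ↦ ((n : ℝ) + 1)⁻¹) N
        push_cast at this
        simp only [this]
        simpa using hlim.const_sub 1
      · intro n
        rw [sub_nonneg]
        gcongr
        linarith
    rw [← hasSum_nat_add_iff' 1]
    simpa using h1.neg
  have one : HasSum (fun n : ℤ ↦ ((n : ℝ) + 1)⁻¹ - (n : ℝ)⁻¹) 0 := by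
    rw [← add_zero (0 : ℝ)]
    refine HasSum.of_nat_of_neg_add_one (by simpa using tel) ?_
    convert tel using 2 with n
    push_cast
    rw [show -((n : ℝ) + 1) + 1 = -n by ring, inv_neg, inv_neg]
    ring
  induction k with
  | zero =>
    convert hasSum_zero (α := ℝ) (β := ℤ) using 2 with n
    simp
  | succ k ih =>
    have h := (Equiv.subRight ((k : ℤ) + 1)).hasSum_iff.mpr one
    convert ih.add h using 1
    · ext n
      simp only [Function.comp_apply, Equiv.subRight_apply]
      push_cast
      rw [show (n : ℝ) - (k + 1) + 1 = -(k - n) by ring,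
        show (n : ℝ) - (k + 1) = -(k + 1 - n) by ring, inv_neg, inv_neg]
      ring
    · simp

/-- The sum of `n⁻ˢ (k - n)⁻ᵗ` over all integers `n ≠ 0, k`; these two indices contribute nothing
because `0⁻¹ = 0`. In the partial fractions they do contribute, which the last term corrects. -/
theorem hasSum_int_inv_pow_mul_inv_pow {k : ℕ} (hk : 0 < k) (a b : ℕ) :
    HasSum (fun n : ℤ ↦ (n : ℝ)⁻¹ ^ (a + 1) * ((k : ℝ) - n)⁻¹ ^ (b + 1))
      (∑ j ∈ Finset.range a, ((b + j).choose b : ℝ) *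
          ((1 + (-1) ^ (a + 1 - j)) * zetaValue (a + 1 - j)) * (k : ℝ)⁻¹ ^ (b + 1 + j) +
        ∑ j ∈ Finset.range b, ((a + j).choose a : ℝ) *
          ((1 + (-1) ^ (b + 1 - j)) * zetaValue (b + 1 - j)) * (k : ℝ)⁻¹ ^ (a + 1 + j) -
        (((a + b + 1).choose (b + 1) : ℝ) + ((a + b + 1).choose (a + 1) : ℝ)) *
          (k : ℝ)⁻¹ ^ (a + b + 2)) := by
  have hk0 : (k : ℝ) ≠ 0 := by positivity
  have key (n : ℤ) : (n : ℝ)⁻¹ ^ (a + 1) * ((k : ℝ) - n)⁻¹ ^ (b + 1) =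
      ∑ j ∈ Finset.range a, ((b + j).choose b : ℝ) *
          (n : ℝ)⁻¹ ^ (a + 1 - j) * (k : ℝ)⁻¹ ^ (b + 1 + j) +
        ∑ j ∈ Finset.range b, ((a + j).choose a : ℝ) *
          ((k : ℝ) - n)⁻¹ ^ (b + 1 - j) * (k : ℝ)⁻¹ ^ (a + 1 + j) +
        ((a + b).choose a : ℝ) * (k : ℝ)⁻¹ ^ (a + b + 1) * ((n : ℝ)⁻¹ + ((k : ℝ) - n)⁻¹) -
        (if n = k then ((a + b + 1).choose (b + 1) : ℝ) * (k : ℝ)⁻¹ ^ (a + b + 2) else 0) -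
        (if n = 0 then ((a + b + 1).choose (a + 1) : ℝ) * (k : ℝ)⁻¹ ^ (a + b + 2) else 0) := by
    -- Put the two terms with exponent `1` back into the sums.
    have full (X Y L : ℝ) :
        ∑ j ∈ Finset.range a, ((b + j).choose b : ℝ) * X ^ (a + 1 - j) * L ^ (b + 1 + j) +
          ∑ j ∈ Finset.range b, ((a + j).choose a : ℝ) * Y ^ (b + 1 - j) * L ^ (a + 1 + j) +
          ((a + b).choose a : ℝ) * L ^ (a + b + 1) * (X + Y) =
        ∑ j ∈ Finset.range (a + 1), ((b + j).choose b : ℝ) * X ^ (a + 1 - j) * L ^ (b + 1 + j) +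
          ∑ j ∈ Finset.range (b + 1),
            ((a + j).choose a : ℝ) * Y ^ (b + 1 - j) * L ^ (a + 1 + j) := by
      rw [Finset.sum_range_succ, Finset.sum_range_succ, Nat.add_sub_cancel_left,
        Nat.add_sub_cancel_left, add_comm b a, ← Nat.choose_symm_add (a := a) (b := b)]
      ring
    -- The degenerate case `X = L`, of the first sum for `n = k` and of the second for `n = 0`.
    have diag (L : ℝ) (a b : ℕ) :
        ∑ j ∈ Finset.range (a + 1), ((b + j).choose b : ℝ) * L ^ (a + 1 - j) * L ^ (b + 1 + j) =
          ((a + b + 1).choose (b + 1) : ℝ) * L ^ (a + b + 2) := by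
      rw [← sum_range_add_choose_cast, Finset.sum_mul]
      refine Finset.sum_congr rfl fun j hj ↦ ?_
      rw [Finset.mem_range] at hj
      rw [mul_assoc, ← pow_add, show a + 1 - j + (b + 1 + j) = a + b + 2 by omega]
    have vanish (L : ℝ) (a b : ℕ) :
        ∑ j ∈ Finset.range (a + 1),
          ((b + j).choose b : ℝ) * (0 : ℝ) ^ (a + 1 - j) * L ^ (b + 1 + j) = 0 := by
      refine Finset.sum_eq_zero fun j hj ↦ ?_
      rw [Finset.mem_range] at hj
      rw [zero_pow (by omega)]
      ring
    rw [full]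
    by_cases h0 : n = 0
    · subst h0
      have : (0 : ℤ) ≠ k := by omega
      simp only [Int.cast_zero, inv_zero, sub_zero, if_neg this, if_true, vanish, diag,
        add_comm b a]
      simp
    by_cases h1 : n = k
    · subst h1
      simp only [Int.cast_natCast, sub_self, inv_zero, if_neg h0, if_true, vanish, diag]
      simp
    rw [if_neg h0, if_neg h1, sub_zero, sub_zero]
    refine pow_mul_pow_eq_sum_of_mul_eq ?_ a b
    have hn : (n : ℝ) ≠ 0 := by exact_mod_cast h0
    have hkn : (k : ℝ) - n ≠ 0 := sub_ne_zero.mpr fun h ↦ h1 (by exact_mod_cast h.symm)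
    field_simp
    ring
  simp only [key]
  have refl {c : ℕ} (hc : 2 ≤ c) : HasSum (fun n : ℤ ↦ ((k : ℝ) - n)⁻¹ ^ c)
      ((1 + (-1) ^ c) * zetaValue c) := by
    have := (Equiv.subLeft (k : ℤ)).hasSum_iff.mpr (hasSum_int_inv_pow hc)
    simpa [Function.comp_def] using this
  have h1 := hasSum_sum (s := Finset.range a) fun j hj ↦
    ((hasSum_int_inv_pow (a := a + 1 - j) (by rw [Finset.mem_range] at hj; omega)).mul_left
      ((b + j).choose b : ℝ)).mul_right ((k : ℝ)⁻¹ ^ (b + 1 + j))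
  have h2 := hasSum_sum (s := Finset.range b) fun j hj ↦
    ((refl (c := b + 1 - j) (by rw [Finset.mem_range] at hj; omega)).mul_left
      ((a + j).choose a : ℝ)).mul_right ((k : ℝ)⁻¹ ^ (a + 1 + j))
  have h3 := (hasSum_int_inv_add_inv k).mul_left
    (((a + b).choose a : ℝ) * (k : ℝ)⁻¹ ^ (a + b + 1))
  have h4 := hasSum_ite_eq (k : ℤ) (((a + b + 1).choose (b + 1) : ℝ) * (k : ℝ)⁻¹ ^ (a + b + 2))
  have h5 := hasSum_ite_eq (0 : ℤ) (((a + b + 1).choose (a + 1) : ℝ) * (k : ℝ)⁻¹ ^ (a + b + 2))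
  convert (((h1.add h2).add h3).sub h4).sub h5 using 1
  · rfl
  · ring

/-! ### Relations between double zeta values -/

theorem hasSum_posInvPow_mul {s t : ℕ} (hs : 2 ≤ s) (ht : 2 ≤ t) :
    HasSum (fun p : ℤ × ℤ ↦ posInvPow s p.1 * posInvPow t p.2) (zetaValue s * zetaValue t) :=
  (hasSum_posInvPow hs).mul (hasSum_posInvPow ht)
    ((hasSum_posInvPow hs).summable.mul_of_nonneg (hasSum_posInvPow ht).summable
      (fun n ↦ by simp only [posInvPow]; split_ifs <;> positivity)
      (fun n ↦ by simp only [posInvPow]; split_ifs <;> positivity))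

theorem hasSum_doubleZeta {s t : ℕ} (hs : 2 ≤ s) (ht : 2 ≤ t) :
    HasSum (fun p : ℤ × ℤ ↦ if p.2 < p.1 then posInvPow s p.1 * posInvPow t p.2 else 0)
      (doubleZeta s t) :=
  ((hasSum_posInvPow_mul hs ht).summable.indicator {p | p.2 < p.1}).congr
    (fun p ↦ by simp [Set.indicator]) |>.hasSum

/-- The stuffle relation: the terms of the product `ζ(s) ζ(t)` split into `n > m`, `m > n` and
`n = m`. -/
theorem zetaValue_mul_zetaValue {s t : ℕ} (hs : 2 ≤ s) (ht : 2 ≤ t) :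
    zetaValue s * zetaValue t = doubleZeta s t + doubleZeta t s + zetaValue (s + t) := by
  have hd : HasSum (fun p : ℤ × ℤ ↦ if p.1 = p.2 then posInvPow s p.1 * posInvPow t p.2 else 0)
      (zetaValue (s + t)) := by
    rw [← Function.Injective.hasSum_iff (g := fun n : ℤ ↦ (n, n)) fun x y h ↦ congrArg Prod.fst h]
    · convert hasSum_posInvPow (a := s + t) (by omega) using 1
      ext n
      simp only [Function.comp_apply, if_true, posInvPow]
      split_ifs <;> simp [pow_add]
    · rintro ⟨n, m⟩ h
      exact if_neg fun e : n = m ↦ h ⟨n, by simp [e]⟩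
  have hswap := (Equiv.prodComm ℤ ℤ).hasSum_iff.mpr (hasSum_doubleZeta ht hs)
  refine (hasSum_posInvPow_mul hs ht).unique ?_
  convert ((hasSum_doubleZeta hs ht).add hswap).add hd using 2 with p
  simp only [Function.comp_apply, Equiv.prodComm_apply, Prod.fst_swap, Prod.snd_swap]
  rcases lt_trichotomy p.1 p.2 with h | h | h
  · simp [h, h.not_gt, h.ne, mul_comm]
  · simp [h]
  · simp [h, h.not_gt, h.ne']

/-- The sum of `n⁻ˢ m⁻ᵗ` over all integers `n` and `m` with `n + m > 0`, split by the signs of `n`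
and `m`. -/
theorem hasSum_halfPlane_signs {s t : ℕ} (hs : 2 ≤ s) (ht : 2 ≤ t) :
    HasSum (fun p : ℤ × ℤ ↦ if 0 < p.1 + p.2 then (p.1 : ℝ)⁻¹ ^ s * (p.2 : ℝ)⁻¹ ^ t else 0)
      (zetaValue s * zetaValue t + (-1) ^ t * doubleZeta s t + (-1) ^ s * doubleZeta t s) := by
  have h2 := ((Equiv.refl ℤ).prodCongr (Equiv.neg ℤ)).hasSum_iff.mpr (hasSum_doubleZeta hs ht)
  have h3 := ((Equiv.prodComm ℤ ℤ).trans ((Equiv.refl ℤ).prodCongr (Equiv.neg ℤ))).hasSum_iff.mpr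
    (hasSum_doubleZeta ht hs)
  convert ((hasSum_posInvPow_mul hs ht).add (h2.mul_left ((-1) ^ t))).add
    (h3.mul_left ((-1) ^ s)) using 2 with p
  obtain ⟨n, m⟩ := p
  simp only [inv_pow_eq_posInvPow (show s ≠ 0 by omega), inv_pow_eq_posInvPow (show t ≠ 0 by omega)]
  simp only [Function.comp_apply, Equiv.prodCongr_apply, Prod.map, Equiv.refl_apply,
    Equiv.neg_apply, Equiv.trans_apply, Equiv.prodComm_apply, Prod.swap]
  simp only [posInvPow]
  split_ifs <;> first | omega | ring

/-- The sum of `n⁻ˢ m⁻ᵗ` over all integers `n` and `m` with `n + m > 0`, evaluated along the lines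
`n + m = k` by partial fractions. -/
theorem hasSum_halfPlane_lines {a b : ℕ} (ha : 1 ≤ a) (hb : 1 ≤ b) :
    HasSum (fun p : ℤ × ℤ ↦
        if 0 < p.1 + p.2 then (p.1 : ℝ)⁻¹ ^ (a + 1) * (p.2 : ℝ)⁻¹ ^ (b + 1) else 0)
      (∑ j ∈ Finset.range a, ((b + j).choose b : ℝ) *
          ((1 + (-1) ^ (a + 1 - j)) * zetaValue (a + 1 - j)) * zetaValue (b + 1 + j) +
        ∑ j ∈ Finset.range b, ((a + j).choose a : ℝ) *
          ((1 + (-1) ^ (b + 1 - j)) * zetaValue (b + 1 - j)) * zetaValue (a + 1 + j) -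
        (((a + b + 1).choose (b + 1) : ℝ) + ((a + b + 1).choose (a + 1) : ℝ)) *
          zetaValue (a + b + 2)) := by
  have h := (hasSum_halfPlane_signs (s := a + 1) (t := b + 1) (by omega) (by omega)).summable.hasSum
  -- The shear `(k, n) ↦ (n, k - n)` of `ℤ × ℤ`.
  let e : ℤ × ℤ ≃ ℤ × ℤ :=
    { toFun := fun p ↦ (p.2, p.1 - p.2)
      invFun := fun p ↦ (p.1 + p.2, p.1)
      left_inv := fun p ↦ by simp
      right_inv := fun p ↦ by simp }
  have hlines := (e.hasSum_iff.mpr h).prod_fiberwise (g := fun k : ℤ ↦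
      ∑ j ∈ Finset.range a, ((b + j).choose b : ℝ) *
          ((1 + (-1) ^ (a + 1 - j)) * zetaValue (a + 1 - j)) * posInvPow (b + 1 + j) k +
        ∑ j ∈ Finset.range b, ((a + j).choose a : ℝ) *
          ((1 + (-1) ^ (b + 1 - j)) * zetaValue (b + 1 - j)) * posInvPow (a + 1 + j) k -
        (((a + b + 1).choose (b + 1) : ℝ) + ((a + b + 1).choose (a + 1) : ℝ)) *
          posInvPow (a + b + 2) k) fun k ↦ by
    rcases le_or_gt k 0 with hk | hk
    · simp [e, posInvPow, hk.not_gt, hasSum_zero]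
    · lift k to ℕ using hk.le
      have hk' : 0 < k := by exact_mod_cast hk
      simpa [e, posInvPow, hk'] using hasSum_int_inv_pow_mul_inv_pow hk' a b
  have h1 := hasSum_sum (s := Finset.range a) fun j _ ↦
    (hasSum_posInvPow (a := b + 1 + j) (by omega)).mul_left
      (((b + j).choose b : ℝ) * ((1 + (-1) ^ (a + 1 - j)) * zetaValue (a + 1 - j)))
  have h2 := hasSum_sum (s := Finset.range b) fun j _ ↦
    (hasSum_posInvPow (a := a + 1 + j) (by omega)).mul_left
      (((a + j).choose a : ℝ) * ((1 + (-1) ^ (b + 1 - j)) * zetaValue (b + 1 - j)))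
  have h3 := (hasSum_posInvPow (a := a + b + 2) (by omega)).mul_left
      (((a + b + 1).choose (b + 1) : ℝ) + ((a + b + 1).choose (a + 1) : ℝ))
  rwa [hlines.unique ((h1.add h2).sub h3)] at h

/-- For odd `s + t` the two evaluations of the half-plane sum determine `ζ(s, t) - ζ(t, s)`, while
the stuffle relation determines `ζ(s, t) + ζ(t, s)`. -/
theorem two_mul_doubleZeta {a b : ℕ} (ha : 1 ≤ a) (hb : 1 ≤ b) (hab : Odd (a + b)) :
    2 * (-1) ^ (b + 1) * doubleZeta (a + 1) (b + 1) =
      2 * ∑ k ∈ Finset.Icc 1 ((a + 1) / 2),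
          ((a + b + 1 - 2 * k).choose b : ℝ) * zetaValue (2 * k) *
            zetaValue (a + b + 1 - 2 * k + 1) +
        2 * ∑ k ∈ Finset.Icc 1 ((b + 1) / 2),
          ((a + b + 1 - 2 * k).choose a : ℝ) * zetaValue (2 * k) *
            zetaValue (a + b + 1 - 2 * k + 1) -
        (((a + b + 1).choose (b + 1) : ℝ) + ((a + b + 1).choose (a + 1) : ℝ)) *
          zetaValue (a + b + 2) -
        zetaValue (a + 1) * zetaValue (b + 1) +
        (-1) ^ (b + 1) * (zetaValue (a + 1) * zetaValue (b + 1) - zetaValue (a + b + 2)) := by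
  have reindex (a b : ℕ) : ∑ j ∈ Finset.range a, ((b + j).choose b : ℝ) *
        ((1 + (-1) ^ (a + 1 - j)) * zetaValue (a + 1 - j)) * zetaValue (b + 1 + j) =
      2 * ∑ k ∈ Finset.Icc 1 ((a + 1) / 2), ((a + b + 1 - 2 * k).choose b : ℝ) *
        zetaValue (2 * k) * zetaValue (a + b + 1 - 2 * k + 1) := by
    rw [← sum_range_one_add_neg_one_pow (fun i ↦ ((a + b + 1 - i).choose b : ℝ) *
      zetaValue i * zetaValue (a + b + 1 - i + 1))]
    refine Finset.sum_congr rfl fun j hj ↦ ?_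
    rw [Finset.mem_range] at hj
    rw [show a + b + 1 - (a + 1 - j) = b + j by omega, show b + 1 + j = b + j + 1 by ring]
    ring
  have h1 := (hasSum_halfPlane_signs (s := a + 1) (t := b + 1) (by omega) (by omega)).unique
    (hasSum_halfPlane_lines ha hb)
  have h2 := zetaValue_mul_zetaValue (s := a + 1) (t := b + 1) (by omega) (by omega)
  rw [show a + 1 + (b + 1) = a + b + 2 by ring] at h2
  rw [reindex, reindex, add_comm b a] at h1
  have hsign : (-1 : ℝ) ^ (a + 1) = -(-1) ^ (b + 1) := by
    rcases Nat.even_or_odd b with h | h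
    · rw [((Nat.odd_add.mp hab).mpr h).add_one.neg_one_pow, h.add_one.neg_one_pow, neg_neg]
    · have ha' : Even a := Nat.not_odd_iff_even.mp fun h' ↦
        (Nat.not_even_iff_odd.mpr h) ((Nat.odd_add.mp hab).mp h')
      rw [ha'.add_one.neg_one_pow, h.add_one.neg_one_pow]
  rw [hsign] at h1
  linear_combination h1 - (-1) ^ (b + 1) * h2

/-! ### The integral as a double zeta value -/

theorem continuousOn_pow_mul_log_pow {n : ℕ} (hn : 1 ≤ n) (r : ℕ) :
    ContinuousOn (fun x : ℝ ↦ x ^ n * Real.log x ^ r) (Set.Ici 0) := by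
  -- A single factor `x` already tames the logarithm at `0`.
  have h1 : ContinuousOn (fun x : ℝ ↦ x * Real.log x ^ r) (Set.Ici 0) := by
    intro x hx
    rcases (Set.mem_Ici.mp hx).eq_or_lt with rfl | hx
    · rw [← continuousWithinAt_Ioi_iff_Ici, ContinuousWithinAt, zero_mul]
      have h := (Real.tendsto_pow_log_div_mul_add_atTop 1 0 r one_ne_zero).comp
        tendsto_inv_nhdsGT_zero
      have h' := h.const_mul ((-1) ^ r)
      rw [mul_zero] at h'
      refine h'.congr fun x ↦ ?_
      simp only [Function.comp_apply, Real.log_inv, one_mul, add_zero, div_inv_eq_mul]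
      rw [← mul_assoc, ← mul_pow]
      ring
    · exact (continuousAt_id.mul ((Real.continuousAt_log hx.ne').pow r)).continuousWithinAt
  obtain ⟨m, rfl⟩ := Nat.exists_eq_add_of_le hn
  convert ((continuous_pow m).continuousOn (s := Set.Ici (0 : ℝ))).mul h1 using 1
  ext x
  simp only [Pi.mul_apply]
  ring

theorem intervalIntegrable_pow_mul_log_pow {n : ℕ} (hn : 1 ≤ n) (r : ℕ) :
    IntervalIntegrable (fun x : ℝ ↦ x ^ n * Real.log x ^ r) MeasureTheory.volume 0 1 := by
  refine ((continuousOn_pow_mul_log_pow hn r).mono ?_).intervalIntegrable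
  rw [Set.uIcc_of_le zero_le_one]
  exact Set.Icc_subset_Ici_self

theorem integral_pow_mul_log_pow {n : ℕ} (hn : 1 ≤ n) (r : ℕ) :
    ∫ x in (0 : ℝ)..1, x ^ n * Real.log x ^ r =
      (-1) ^ r * r.factorial * ((n : ℝ) + 1)⁻¹ ^ (r + 1) := by
  induction r with
  | zero => simp
  | succ r ih =>
    have hi := ((intervalIntegrable_pow_mul_log_pow hn (r + 1)).const_mul ((n : ℝ) + 1))
    have hi' := ((intervalIntegrable_pow_mul_log_pow hn r).const_mul ((r : ℝ) + 1))
    have := intervalIntegral.integral_eq_sub_of_hasDerivAt_of_le (a := 0) (b := 1) zero_le_one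
      (f := fun x : ℝ ↦ x ^ (n + 1) * Real.log x ^ (r + 1))
      ((continuousOn_pow_mul_log_pow (by omega) _).mono Set.Icc_subset_Ici_self)
      (f' := fun x ↦ ((n : ℝ) + 1) * (x ^ n * Real.log x ^ (r + 1)) +
        ((r : ℝ) + 1) * (x ^ n * Real.log x ^ r))
      (fun x hx ↦ by
        have hx0 : x ≠ 0 := hx.1.ne'
        convert! (hasDerivAt_pow (n + 1) x).mul ((Real.hasDerivAt_log hx0).pow (r + 1)) using 1
        simp only [Nat.add_sub_cancel, Pi.pow_apply]
        push_cast
        field_simp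
        ring)
      (hi.add hi')
    rw [intervalIntegral.integral_add hi hi', intervalIntegral.integral_const_mul,
      intervalIntegral.integral_const_mul, ih] at this
    have hn0 : (n : ℝ) + 1 ≠ 0 := by positivity
    simp only [Real.log_one, one_pow, zero_pow (Nat.succ_ne_zero r), mul_zero,
      zero_pow (Nat.succ_ne_zero n), zero_mul, sub_zero] at this
    rw [Nat.factorial_succ]
    push_cast
    refine mul_left_cancel₀ hn0 ?_
    linear_combination this - (-1) ^ (r + 1) * ((r : ℝ) + 1) * r.factorial *
      ((n : ℝ) + 1)⁻¹ ^ (r + 1) * mul_inv_cancel₀ hn0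

/-- The double zeta value as a sum over `n = m + (j + 1)` and `m = j + 1`. -/
theorem hasSum_nat_doubleZeta {s t : ℕ} (hs : 2 ≤ s) (ht : 2 ≤ t) :
    HasSum (fun p : ℕ × ℕ ↦ ((p.1 : ℝ) + p.2 + 2)⁻¹ ^ s * ((p.2 : ℝ) + 1)⁻¹ ^ t)
      (doubleZeta s t) := by
  have h := hasSum_doubleZeta hs ht
  rw [← Function.Injective.hasSum_iff
    (g := fun p : ℕ × ℕ ↦ ((p.1 + p.2 + 2 : ℤ), (p.2 + 1 : ℤ)))] at h
  · convert h using 2 with p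
    simp only [Function.comp_apply, posInvPow]
    rw [if_pos (by omega), if_pos (by omega), if_pos (by omega)]
    push_cast
    rfl
  · rintro ⟨a, b⟩ ⟨c, d⟩ h
    simp only [Prod.mk.injEq] at h ⊢
    omega
  · rintro ⟨n, m⟩ h
    by_cases hp : 0 < m ∧ m < n
    · exact absurd ⟨((n - m - 1).toNat, (m - 1).toNat), by simp only [Prod.mk.injEq]; omega⟩ h
    · simp only [posInvPow]
      split_ifs <;> first | omega | simp

theorem hasSum_polylog {q : ℕ} (r : ℕ) {x : ℝ} (hx : x ∈ Set.Ioo (0 : ℝ) 1) :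
    HasSum (fun p : ℕ × ℕ ↦ ((p.2 : ℝ) + 1)⁻¹ ^ q * (x ^ (p.1 + p.2 + 1) * Real.log x ^ r))
      (Real.log x ^ r * polylog q x / (1 - x)) := by
  have hg := hasSum_geometric_of_lt_one hx.1.le hx.2
  have hl : Summable fun j : ℕ ↦ x ^ (j + 1) / ((j : ℝ) + 1) ^ q := by
    refine Summable.of_nonneg_of_le (fun j ↦ by have := hx.1; positivity) (fun j ↦ ?_) hg.summable
    refine (div_le_self (by have := hx.1; positivity) (one_le_pow₀ (by simp))).trans ?_
    exact pow_le_pow_of_le_one hx.1.le hx.2.le (Nat.le_succ j)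
  have h := hg.mul hl.hasSum (hg.summable.mul_of_nonneg hl
    (fun j ↦ by have := hx.1; positivity) (fun j ↦ by have := hx.1; positivity))
  convert h.mul_left (Real.log x ^ r) using 1
  · rfl
  · ext p
    rw [inv_pow]
    ring
  · rw [polylog.eq_def, div_eq_mul_inv]
    ring

/-- The signs of the terms do not depend on the index, so termwise integration gives both the value
and, this value being nonzero, the integrability. -/
theorem integral_log_pow_mul_polylog {r q : ℕ} (hr : 1 ≤ r) (hq : 2 ≤ q) :
    IntervalIntegrable (fun x : ℝ ↦ Real.log x ^ r * polylog q x / (1 - x))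
        MeasureTheory.volume 0 1 ∧
      ∫ x in (0 : ℝ)..1, Real.log x ^ r * polylog q x / (1 - x) =
        (-1) ^ r * r.factorial * doubleZeta (r + 1) q := by
  let F : ℕ × ℕ → ℝ → ℝ := fun p x ↦
    ((p.2 : ℝ) + 1)⁻¹ ^ q * (x ^ (p.1 + p.2 + 1) * Real.log x ^ r)
  have hdz := hasSum_nat_doubleZeta (s := r + 1) (by omega) hq
  have hFint (p) : MeasureTheory.Integrable (F p)
      (MeasureTheory.volume.restrict (Set.Ioo (0 : ℝ) 1)) := by
    have := (intervalIntegrable_pow_mul_log_pow (n := p.1 + p.2 + 1) (by omega) r).const_mul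
      (((p.2 : ℝ) + 1)⁻¹ ^ q)
    rwa [intervalIntegrable_iff_integrableOn_Ioo_of_le zero_le_one] at this
  have hFval (p) : ∫ x in Set.Ioo (0 : ℝ) 1, F p x = (-1) ^ r * r.factorial *
      (((p.1 : ℝ) + p.2 + 2)⁻¹ ^ (r + 1) * ((p.2 : ℝ) + 1)⁻¹ ^ q) := by
    rw [← MeasureTheory.integral_Ioc_eq_integral_Ioo,
      ← intervalIntegral.integral_of_le zero_le_one, intervalIntegral.integral_const_mul,
      integral_pow_mul_log_pow (by omega)]
    push_cast
    rw [show (p.1 : ℝ) + p.2 + 1 + 1 = p.1 + p.2 + 2 by ring]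
    ring
  have hFnorm (p) : ∫ x in Set.Ioo (0 : ℝ) 1, ‖F p x‖ = r.factorial *
      (((p.1 : ℝ) + p.2 + 2)⁻¹ ^ (r + 1) * ((p.2 : ℝ) + 1)⁻¹ ^ q) := by
    have : ∫ x in Set.Ioo (0 : ℝ) 1, ‖F p x‖ = ∫ x in Set.Ioo (0 : ℝ) 1, (-1) ^ r * F p x := by
      refine MeasureTheory.setIntegral_congr_fun measurableSet_Ioo fun x hx ↦ ?_
      have hlog : |Real.log x| = -Real.log x := abs_of_neg (Real.log_neg hx.1 hx.2)
      have hx0 : |x| = x := abs_of_pos hx.1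
      have hp : |((p.2 : ℝ) + 1)| = (p.2 : ℝ) + 1 := abs_of_pos (by positivity)
      simp only [F, Real.norm_eq_abs, abs_mul, abs_pow, abs_inv, hlog, hx0, hp]
      rw [neg_pow]
      ring
    rw [this, MeasureTheory.integral_const_mul, hFval, ← mul_assoc, ← mul_assoc ((-1) ^ r),
      ← pow_add, (Even.add_self r).neg_one_pow, one_mul]
  have key := MeasureTheory.hasSum_integral_of_summable_integral_norm hFint (by
    simp only [hFnorm]
    exact hdz.summable.mul_left _)
  have hcongr : ∫ x in Set.Ioo (0 : ℝ) 1, ∑' p, F p x =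
      ∫ x in Set.Ioo (0 : ℝ) 1, Real.log x ^ r * polylog q x / (1 - x) :=
    MeasureTheory.setIntegral_congr_fun measurableSet_Ioo fun x hx ↦ (hasSum_polylog r hx).tsum_eq
  simp only [hFval, hcongr] at key
  have hval := key.unique (hdz.mul_left _)
  have hpos : 0 < doubleZeta (r + 1) q :=
    hdz.tsum_eq ▸ hdz.summable.tsum_pos (fun p ↦ by positivity) (0, 0) (by positivity)
  constructor
  · rw [intervalIntegrable_iff_integrableOn_Ioo_of_le zero_le_one]
    refine MeasureTheory.Integrable.of_integral_ne_zero ?_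
    rw [hval]
    exact mul_ne_zero (mul_ne_zero (pow_ne_zero _ (by norm_num)) (by positivity)) hpos.ne'
  · rw [intervalIntegral.integral_of_le zero_le_one, MeasureTheory.integral_Ioc_eq_integral_Ioo,
      hval]

theorem polylogIntegral_zero (r q : ℕ) :
    polylogIntegral r 0 q = ∫ x in (0 : ℝ)..1, Real.log x ^ r * polylog q x / (1 - x) := by
  rw [polylogIntegral, intervalIntegral.integral_of_le zero_le_one,
    intervalIntegral.integral_of_le zero_le_one, MeasureTheory.integral_Ioc_eq_integral_Ioo,
    MeasureTheory.integral_Ioc_eq_integral_Ioo]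
  refine MeasureTheory.setIntegral_congr_fun measurableSet_Ioo fun x hx ↦ ?_
  have h0 : polylog 0 x = x / (1 - x) := by
    simp only [polylog, pow_zero, div_one, pow_succ, tsum_mul_right]
    rw [tsum_geometric_of_lt_one hx.1.le hx.2]
    ring
  have hx0 : x ≠ 0 := hx.1.ne'
  have hx1 : 1 - x ≠ 0 := (sub_pos.mpr hx.2).ne'
  simp only [h0]
  field_simp

/-! ### Reducibility and the closed formula -/

theorem reducibleToZetaValues_zetaValue {n : ℕ} (hn : 1 ≤ n) :
    ReducibleToZetaValues (zetaValue n) := by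
  rcases hn.eq_or_lt with rfl | hn
  · rw [show zetaValue 1 = 0 from if_pos rfl]
    exact Subalgebra.zero_mem _
  · exact Algebra.subset_adjoin ⟨n, hn, rfl⟩

theorem reducibleToZetaValues_ratCast (c : ℚ) : ReducibleToZetaValues (c : ℝ) :=
  Subalgebra.algebraMap_mem (Algebra.adjoin ℚ {y : ℝ | ∃ n : ℕ, 2 ≤ n ∧ y = zetaValue n}) c

theorem theorem3p1 (r q w : ℕ) (hq : 2 ≤ q) (hr : 1 ≤ r) (hw : w = q + r) (heven : Even w) :
    IntervalIntegrable (fun x : ℝ => Real.log x ^ r * polylog q x / (1 - x))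
      MeasureTheory.volume 0 1 ∧
    polylogIntegral r 0 q = ∫ x in (0 : ℝ)..1, Real.log x ^ r * polylog q x / (1 - x) ∧
    ReducibleToZetaValues (polylogIntegral r 0 q) ∧
    polylogIntegral r 0 q =
      (r.factorial : ℝ) *
        ((-1) ^ (r + 1) * zetaValue (w + 1) *
            (1 / 2 - (-1) ^ (r + 1) / 2 * (w.choose (r + 1) : ℝ)
              - (-1) ^ (r + 1) / 2 * (w.choose q : ℝ))
          + ((-1) ^ r - 1) / 2 * zetaValue (r + 1) * zetaValue q
          + ∑ k ∈ Finset.Icc 1 ((r + 1) / 2),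
              ((w - 2 * k).choose (q - 1) : ℝ) * zetaValue (2 * k) * zetaValue (w - 2 * k + 1)
          + ∑ k ∈ Finset.Icc 1 (q / 2),
              ((w - 2 * k).choose r : ℝ) * zetaValue (2 * k) * zetaValue (w - 2 * k + 1)) := by
  have hint := integral_log_pow_mul_polylog hr hq
  have hK := (polylogIntegral_zero r q).trans hint.2
  have hsign : (-1 : ℝ) ^ q = (-1) ^ r := by
    rw [hw, Nat.even_add] at heven
    rcases Nat.even_or_odd r with h | h
    · rw [h.neg_one_pow, (heven.mpr h).neg_one_pow]
    · rw [h.neg_one_pow, (Nat.not_even_iff_odd.mp fun h' ↦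
        Nat.not_even_iff_odd.mpr h (heven.mp h')).neg_one_pow]
  have hsq : ((-1 : ℝ) ^ r) ^ 2 = 1 := by rw [← pow_mul, mul_comm, pow_mul]; norm_num
  obtain ⟨b, rfl⟩ := Nat.exists_eq_add_of_le' (show 1 ≤ q by omega)
  have hwr : w = r + b + 1 := by omega
  have hodd : Odd (r + b) := by
    rw [hwr] at heven
    exact Nat.not_even_iff_odd.mp fun h ↦ Nat.not_even_iff_odd.mpr h.add_one heven
  have hdz := two_mul_doubleZeta hr (show 1 ≤ b by omega) hodd
  rw [← hwr, show r + b + 2 = w + 1 by omega, hsign] at hdz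
  have hformula := hK
  rw [show (-1) ^ r * (r.factorial : ℝ) * doubleZeta (r + 1) (b + 1) =
    r.factorial * ((2 * (-1) ^ r * doubleZeta (r + 1) (b + 1)) / 2) by ring, hdz] at hformula
  have hvalue : polylogIntegral r 0 (b + 1) =
      (r.factorial : ℝ) *
        ((-1) ^ (r + 1) * zetaValue (w + 1) *
            (1 / 2 - (-1) ^ (r + 1) / 2 * (w.choose (r + 1) : ℝ)
              - (-1) ^ (r + 1) / 2 * (w.choose (b + 1) : ℝ))
          + ((-1) ^ r - 1) / 2 * zetaValue (r + 1) * zetaValue (b + 1)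
          + ∑ k ∈ Finset.Icc 1 ((r + 1) / 2),
              ((w - 2 * k).choose (b + 1 - 1) : ℝ) * zetaValue (2 * k) * zetaValue (w - 2 * k + 1)
          + ∑ k ∈ Finset.Icc 1 ((b + 1) / 2),
              ((w - 2 * k).choose r : ℝ) * zetaValue (2 * k) * zetaValue (w - 2 * k + 1)) := by
    rw [hformula, Nat.add_sub_cancel, pow_succ]
    linear_combination (r.factorial : ℝ) * zetaValue (w + 1) / 2 *
      ((w.choose (r + 1) : ℝ) + (w.choose (b + 1) : ℝ)) * hsq
  refine ⟨hint.1, polylogIntegral_zero r _, ?_, hvalue⟩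
  have hζ {n : ℕ} (hn : 1 ≤ n) := reducibleToZetaValues_zetaValue hn
  have hc (c : ℚ) := reducibleToZetaValues_ratCast c
  have hsum (m : ℕ → ℕ) (N : ℕ) : ReducibleToZetaValues (∑ k ∈ Finset.Icc 1 N,
      (m k : ℝ) * zetaValue (2 * k) * zetaValue (w - 2 * k + 1)) :=
    Subalgebra.sum_mem _ fun k hk ↦ Subalgebra.mul_mem _ (Subalgebra.mul_mem _
      (by simp)
      (hζ (by rw [Finset.mem_Icc] at hk; omega))) (hζ (by omega))
  rw [hvalue]
  refine Subalgebra.mul_mem _ (by simp)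
    (Subalgebra.add_mem _ (Subalgebra.add_mem _ (Subalgebra.add_mem _
      (Subalgebra.mul_mem _ (Subalgebra.mul_mem _ ?_ (hζ (by omega))) ?_)
      (Subalgebra.mul_mem _ (Subalgebra.mul_mem _ ?_ (hζ (by omega))) (hζ (by omega))))
      (hsum _ _)) (hsum _ _))
  · simpa [ReducibleToZetaValues] using hc ((-1) ^ (r + 1))
  · simpa [ReducibleToZetaValues] using hc (1 / 2 - (-1) ^ (r + 1) / 2 * (w.choose (r + 1) : ℚ)
      - (-1) ^ (r + 1) / 2 * (w.choose (b + 1) : ℚ))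
  · simpa [ReducibleToZetaValues] using hc (((-1) ^ r - 1) / 2)
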